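/- Let $n\ge 1$ and $m\ge 0$ be integers, and let $g(x)=\|x\|^m\tanh\|x\|$ and $u(x)=\|x\|^m$ for $x\in\mathbb{R}^n$, with $\|\cdot\|$ the Euclidean norm. Let $\hat g$ and $\hat u$ be the generalised Fourier transforms of $g$ and $u$, i.e. the Fourier transforms of the tempered distributions $\varphi\mapsto\int_{\mathbb{R}^n} g\varphi\,dx$ and $\varphi\mapsto\int_{\mathbb{R}^n} u\varphi\,dx$, defined by $\langle \hat T,\varphi\rangle=\langle T,\hat\varphi\rangle$ for Schwartz functions $\varphi$, where $\hat\varphi(y)=\int_{\mathbb{R}^n}\varphi(x)e^{-i x\cdot y}\,dx$. For $j\ge 0$ put $$p_j=\frac{(-1)^j}{2^{2j}j!}\left(\sum_{k=1}^\infty\frac{(-1)^k}{k^{m+2j+n}}\right)\prod_{i=0}^{m-1}(n+2j+i)\;\Gamma\!\left(j+\tfrac{n+1}{2}\right).$$ Then the sums over $k$ converge (as limits of their partial sums), the power series $\sum_{j\ge0}p_j\|y\|^{2j}$ converges absolutely for $\|y\|<1$, and in the open unit ball $$\hat g(y)=\hat u(y)+2^{-m+1}\pi^{\frac{n-1}{2}}\sum_{j=0}^\infty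 p_j\|y\|^{2j},$$ as an identity of distributions: the series is locally integrable there, and $\hat g-\hat u$ equals the function given by the last term when tested against every smooth function with compact support in $\{y:\|y\|<1\}$. -/

import Mathlib

open MeasureTheory SchwartzMap
open scoped FourierTransform

noncomputable section

/-- Euclidean space `ℝⁿ`. -/
abbrev Euc (n : ℕ) : Type := EuclideanSpace ℝ (Fin n)

/-! ### Regular tempered distributions -/

/-- A measurable function of at most polynomial growth. -/
structure HasPolyGrowth {n : ℕ} (f : Euc n → ℂ) : Prop where
  aestronglyMeasurable : AEStronglyMeasurable f volume
  bound : ∃ (k : ℕ) (C : ℝ), 0 ≤ C ∧ ∀ x, ‖f x‖ ≤ C * (1 + ‖x‖) ^ k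

/-- Pointwise bound behind the integrability of `φ * f` and the continuity of `φ ↦ ∫ φ * f`. -/
theorem norm_schwartz_mul_le {n : ℕ} {f : Euc n → ℂ} {k N : ℕ} {C : ℝ} (hC : 0 ≤ C)
    (hf : ∀ x, ‖f x‖ ≤ C * (1 + ‖x‖) ^ k) (φ : 𝓢(Euc n, ℂ)) (x : Euc n) :
    ‖φ x * f x‖ ≤ (1 + ‖x‖) ^ (-(N : ℝ)) *
      (C * (2 ^ (k + N) *
        ((Finset.Iic (k + N, 0)).sup (schwartzSeminormFamily ℂ (Euc n) ℂ)) φ)) := by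
  have h := one_add_le_sup_seminorm_apply (𝕜 := ℂ) (m := (k + N, 0)) (k := k + N) (n := 0)
    le_rfl le_rfl φ x
  rw [norm_iteratedFDeriv_zero] at h
  have hpos : 0 < 1 + ‖x‖ := by positivity
  rw [Real.rpow_neg hpos.le, Real.rpow_natCast, ← div_eq_inv_mul, le_div_iff₀' (by positivity),
    norm_mul]
  calc (1 + ‖x‖) ^ N * (‖φ x‖ * ‖f x‖)
      ≤ (1 + ‖x‖) ^ N * (‖φ x‖ * (C * (1 + ‖x‖) ^ k)) := by gcongr; exact hf x
    _ = C * ((1 + ‖x‖) ^ (k + N) * ‖φ x‖) := by ring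
    _ ≤ _ := mul_le_mul_of_nonneg_left h hC

theorem HasPolyGrowth.integrable_mul {n : ℕ} {f : Euc n → ℂ} (hf : HasPolyGrowth f)
    (φ : 𝓢(Euc n, ℂ)) : Integrable (fun x ↦ φ x * f x) volume := by
  obtain ⟨k, C, hC, hb⟩ := hf.bound
  exact ((Measure.integrable_pow_neg_integrablePower (volume : Measure (Euc n))).mul_const _).mono'
    (φ.continuous.aestronglyMeasurable.mul hf.aestronglyMeasurable)
    (Filter.Eventually.of_forall fun x ↦ norm_schwartz_mul_le hC hb φ x)

/-- The continuous functional `φ ↦ ∫ φ(x) f(x) dx` on Schwartz space. -/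
def HasPolyGrowth.toCLM {n : ℕ} {f : Euc n → ℂ} (hf : HasPolyGrowth f) : 𝓢(Euc n, ℂ) →L[ℂ] ℂ :=
  mkCLMtoNormedSpace (fun φ ↦ ∫ x, φ x * f x)
    (fun φ ψ ↦ by
      simpa only [add_apply, add_mul] using
        integral_add (hf.integrable_mul φ) (hf.integrable_mul ψ))
    (fun a φ ↦ by
      simp only [smul_apply, smul_eq_mul, mul_assoc, integral_const_mul, RingHom.id_apply])
    (by
      obtain ⟨k, C, hC, hb⟩ := hf.bound
      set N := (volume : Measure (Euc n)).integrablePower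
      refine ⟨Finset.Iic (k + N, 0),
        (∫ x : Euc n, (1 + ‖x‖) ^ (-(N : ℝ))) * (C * 2 ^ (k + N)), by positivity, fun φ ↦ ?_⟩
      refine (norm_integral_le_integral_norm _).trans ?_
      refine (integral_mono (hf.integrable_mul φ).norm
        ((Measure.integrable_pow_neg_integrablePower (volume : Measure (Euc n))).mul_const _)
        fun x ↦ norm_schwartz_mul_le (N := N) hC hb φ x).trans ?_
      rw [integral_mul_const]
      exact le_of_eq (by ring))

/-- The tempered distribution `φ ↦ ∫ φ(x) f(x) dx` given by a function of polynomial growth. -/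
def HasPolyGrowth.toDistribution {n : ℕ} {f : Euc n → ℂ} (hf : HasPolyGrowth f) :
    𝓢'(Euc n, ℂ) :=
  ContinuousLinearMap.toPointwiseConvergenceCLM _ _ _ _ hf.toCLM

theorem HasPolyGrowth.toDistribution_apply {n : ℕ} {f : Euc n → ℂ} (hf : HasPolyGrowth f)
    (φ : 𝓢(Euc n, ℂ)) : hf.toDistribution φ = ∫ x, φ x * f x := rfl

/-! ### The generalised Fourier transform with kernel `e^{-i x·y}` -/

/-- The dilation `y ↦ y / (2π)`. -/
def dilation (n : ℕ) : Euc n ≃L[ℝ] Euc n :=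
  ContinuousLinearEquiv.smulLeft (Units.mk0 (2 * Real.pi)⁻¹ (by positivity))

/-- The Fourier transform on Schwartz space, `φ̂(y) = ∫ φ(x) e^{-i x·y} dx`
(see `angularFourier_apply`). -/
def angularFourier (n : ℕ) : 𝓢(Euc n, ℂ) →L[ℂ] 𝓢(Euc n, ℂ) :=
  compCLMOfContinuousLinearEquiv ℂ (dilation n) ∘L
    FourierTransform.fourierCLM ℂ 𝓢(Euc n, ℂ)

theorem angularFourier_apply {n : ℕ} (φ : 𝓢(Euc n, ℂ)) (y : Euc n) :
    angularFourier n φ y = ∫ x, φ x * Complex.exp (-Complex.I * (inner ℝ x y : ℝ)) := by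
  have h1 : angularFourier n φ y = (𝓕 (φ : Euc n → ℂ)) ((2 * Real.pi)⁻¹ • y) := rfl
  rw [h1, Real.fourier_eq']
  refine integral_congr_ae (Filter.Eventually.of_forall fun x ↦ ?_)
  have hpi : (Real.pi : ℂ) ≠ 0 := by exact_mod_cast Real.pi_ne_zero
  simp only [smul_eq_mul, inner_smul_right]
  rw [mul_comm]
  congr 2
  push_cast
  field_simp

/-- The generalised (distributional) Fourier transform: `⟨T̂, φ⟩ = ⟨T, φ̂⟩`. -/
def genFourier {n : ℕ} (T : 𝓢'(Euc n, ℂ)) : 𝓢'(Euc n, ℂ) :=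
  PointwiseConvergenceCLM.precomp ℂ (angularFourier n) T

theorem genFourier_apply {n : ℕ} (T : 𝓢'(Euc n, ℂ)) (φ : 𝓢(Euc n, ℂ)) :
    genFourier T φ = T (angularFourier n φ) := rfl

/-- The tempered distribution `T` coincides on the open set `U` with the locally integrable
function `f`: they agree on all test functions compactly supported in `U`. -/
def EqFunctionOn {n : ℕ} (T : 𝓢'(Euc n, ℂ)) (f : Euc n → ℂ) (U : Set (Euc n)) : Prop :=
  LocallyIntegrableOn f U volume ∧
    ∀ φ : 𝓢(Euc n, ℂ), HasCompactSupport φ → tsupport φ ⊆ U →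
      T φ = ∫ y in U, φ y * f y

/-! ### The functions of the theorem -/

/-- `g(x) = ‖x‖^m tanh ‖x‖`. -/
def tanhKernel (n m : ℕ) (x : Euc n) : ℂ := ((‖x‖ ^ m * Real.tanh ‖x‖ : ℝ) : ℂ)

/-- `u(x) = ‖x‖^m`. -/
def powerKernel (n m : ℕ) (x : Euc n) : ℂ := ((‖x‖ ^ m : ℝ) : ℂ)

theorem powerKernel_hasPolyGrowth (n m : ℕ) : HasPolyGrowth (powerKernel n m) where
  aestronglyMeasurable := by
    unfold powerKernel
    exact Continuous.aestronglyMeasurable (by fun_prop)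
  bound := by
    refine ⟨m, 1, zero_le_one, fun x ↦ ?_⟩
    rw [powerKernel, Complex.norm_real, norm_pow, norm_norm, one_mul]
    gcongr
    linarith

theorem tanhKernel_hasPolyGrowth (n m : ℕ) : HasPolyGrowth (tanhKernel n m) where
  aestronglyMeasurable := by
    have h : Continuous Real.tanh := by
      rw [show Real.tanh = fun x ↦ Real.sinh x / Real.cosh x from
        funext Real.tanh_eq_sinh_div_cosh]
      exact Real.continuous_sinh.div Real.continuous_cosh fun x ↦ (Real.cosh_pos x).ne'
    unfold tanhKernel
    exact Continuous.aestronglyMeasurable (by fun_prop)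
  bound := by
    refine ⟨m, 1, zero_le_one, fun x ↦ ?_⟩
    have h : ‖Real.tanh ‖x‖‖ ≤ 1 := by
      rw [Real.tanh_eq_sinh_div_cosh, norm_div, Real.norm_eq_abs, Real.norm_eq_abs,
        abs_of_pos (Real.cosh_pos _)]
      refine div_le_one_of_le₀ ?_ (Real.cosh_pos _).le
      exact abs_le.2 ⟨by linarith [Real.cosh_add_sinh ‖x‖, Real.exp_pos ‖x‖],
        (Real.sinh_lt_cosh _).le⟩
    rw [tanhKernel, Complex.norm_real, norm_mul, norm_pow, norm_norm, one_mul]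
    calc ‖x‖ ^ m * ‖Real.tanh ‖x‖‖ ≤ ‖x‖ ^ m * 1 := by gcongr
      _ ≤ (1 + ‖x‖) ^ m := by rw [mul_one]; gcongr; linarith

/-- `ĝ`, the generalised Fourier transform of `‖x‖^m tanh ‖x‖`. -/
def gHat (n m : ℕ) : 𝓢'(Euc n, ℂ) := genFourier (tanhKernel_hasPolyGrowth n m).toDistribution

/-- `û`, the generalised Fourier transform of `‖x‖^m`. -/
def uHat (n m : ℕ) : 𝓢'(Euc n, ℂ) := genFourier (powerKernel_hasPolyGrowth n m).toDistribution

/-- The term with index `k + 1` of the alternating sum `∑_{k ≥ 1} (-1)^k k^{-s}`. -/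
def altTerm (s k : ℕ) : ℝ := (-1) ^ (k + 1) / ((k : ℝ) + 1) ^ s

/-- `∑_{k ≥ 1} (-1)^k k^{-s}`, the limit of the partial sums. -/
def altZeta (s : ℕ) : ℝ := ∑'[SummationFilter.conditional ℕ] k, altTerm s k

/-- The coefficients `p_j`. -/
def coeffP (n m j : ℕ) : ℝ :=
  (-1) ^ j / (2 ^ (2 * j) * (j.factorial : ℝ)) * altZeta (m + 2 * j + n) *
    (∏ i ∈ Finset.range m, ((n : ℝ) + 2 * j + i)) * Real.Gamma (j + ((n : ℝ) + 1) / 2)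

/-- `2^{-m+1} π^{(n-1)/2} ∑_j p_j ‖y‖^{2j}`. -/
def seriesPart (n m : ℕ) (y : Euc n) : ℂ :=
  (((2 : ℝ) ^ (-(m : ℤ) + 1) * Real.pi ^ (((n : ℝ) - 1) / 2) *
    ∑' j : ℕ, coeffP n m j * ‖y‖ ^ (2 * j) : ℝ) : ℂ)

end

/-! ### The radial integral -/

/-! The difference of the two kernels, `‖x‖ ^ m * (tanh ‖x‖ - 1)`, decays like `exp (-2‖x‖)` and is
integrable, so by Fubini `ĝ - û` is its classical Fourier transform, the continuous function
`diffFourier` (`gHat_sub_uHat_apply`). For `‖y‖ < 1` the decay also allows `exp (-i⟪y, x⟫)` to be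
expanded and integrated term by term (`hasSum_integral_mul_inner_pow`).

In polar coordinates each term is a sphere moment times a radial integral
(`integral_radial_mul_inner_pow`). The expansion `tanh r - 1 = 2 ∑_{k ≥ 1} (-1)^k exp (-2kr)` turns
the radial integral into a Gamma value times the alternating sum (`hasSum_altTerm`). The sphere
moments come from applying the same expansion to a Gaussian, whose transform is known. Legendre
duplication then yields `p_j` (`two_mul_half_pow_mul_Gamma_div`). -/

theorem tanh_sub_one_eq (r : ℝ) :
    Real.tanh r - 1 = -(2 * Real.exp (-(2 * r))) / (1 + Real.exp (-(2 * r))) := by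
  have h : Real.exp (-(2 * r)) = Real.exp (-r) * Real.exp (-r) := by
    rw [← Real.exp_add]; ring_nf
  have h1 : Real.exp r * Real.exp (-r) = 1 := by rw [← Real.exp_add]; simp
  have hp := Real.exp_pos r
  have hq := Real.exp_pos (-r)
  rw [Real.tanh_eq_sinh_div_cosh, Real.sinh_eq, Real.cosh_eq, h]
  have : Real.exp r = (Real.exp (-r))⁻¹ := eq_inv_of_mul_eq_one_left h1
  rw [this]
  field_simp
  ring

theorem abs_tanh_sub_one_le (r : ℝ) : |Real.tanh r - 1| ≤ 2 * Real.exp (-(2 * r)) := by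
  have hq := Real.exp_pos (-(2 * r))
  rw [tanh_sub_one_eq, abs_div, abs_neg, abs_of_pos (by positivity), abs_of_pos (by positivity)]
  exact div_le_self (by positivity) (by linarith)

theorem sum_range_alternating_exp (r : ℝ) (N : ℕ) :
    ∑ k ∈ Finset.range N, (-1 : ℝ) ^ (k + 1) * Real.exp (-(2 * (k + 1) * r)) =
      -Real.exp (-(2 * r)) * (1 - (-Real.exp (-(2 * r))) ^ N) / (1 + Real.exp (-(2 * r))) := by
  set q := Real.exp (-(2 * r)) with hq
  have hq0 : 0 < q := Real.exp_pos _
  have h : ∀ k : ℕ, (-1 : ℝ) ^ (k + 1) * Real.exp (-(2 * (k + 1) * r)) = -q * (-q) ^ k := fun k ↦ by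
    rw [← pow_succ', neg_pow q, hq, ← Real.exp_nat_mul]
    push_cast
    ring_nf
  simp_rw [h]
  rw [← Finset.mul_sum, geom_sum_eq (by linarith)]
  rw [mul_div_assoc, ← neg_div_neg_eq]
  congr 2 <;> ring

theorem tendsto_sum_alternating_exp {r : ℝ} (hr : 0 < r) :
    Filter.Tendsto (fun N ↦ ∑ k ∈ Finset.range N, (-1 : ℝ) ^ (k + 1) *
      Real.exp (-(2 * (k + 1) * r))) Filter.atTop (nhds ((Real.tanh r - 1) / 2)) := by
  simp_rw [sum_range_alternating_exp]
  have hq0 := Real.exp_pos (-(2 * r))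
  have hq1 : Real.exp (-(2 * r)) < 1 := by
    rw [Real.exp_lt_one_iff]; linarith
  have h := tendsto_pow_atTop_nhds_zero_of_abs_lt_one (r := -Real.exp (-(2 * r)))
    (by rw [abs_neg, abs_of_pos hq0]; exact hq1)
  have h2 := ((h.const_sub 1).const_mul (-Real.exp (-(2 * r)))).div_const
    (1 + Real.exp (-(2 * r)))
  convert h2 using 2
  rw [tanh_sub_one_eq]
  ring

/-- Uniform in `N` and bounded near `r = 0`, where the sum of absolute values blows up like `1 / r`;
the alternating signs are essential. -/
theorem abs_sum_alternating_exp_le {r : ℝ} (hr : 0 < r) (N : ℕ) :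
    |∑ k ∈ Finset.range N, (-1 : ℝ) ^ (k + 1) * Real.exp (-(2 * (k + 1) * r))| ≤
      2 * Real.exp (-(2 * r)) := by
  rw [sum_range_alternating_exp]
  have hq0 := Real.exp_pos (-(2 * r))
  have hq1 : Real.exp (-(2 * r)) < 1 := by
    rw [Real.exp_lt_one_iff]; linarith
  rw [abs_div, abs_mul, abs_neg, abs_of_pos hq0, 
    abs_of_pos (add_pos one_pos hq0)]
  refine (div_le_self (by positivity) (by linarith)).trans ?_
  rw [mul_comm]
  gcongr
  refine (abs_sub _ _).trans ?_
  rw [abs_pow, abs_neg, abs_of_pos hq0, abs_one]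
  linarith [pow_le_one₀ hq0.le hq1.le (n := N)]

theorem integrableOn_pow_mul_exp_neg (t : ℕ) {b : ℝ} (hb : 0 < b) :
    IntegrableOn (fun r : ℝ ↦ r ^ t * Real.exp (-(b * r))) (Set.Ioi 0) := by
  have := integrableOn_rpow_mul_exp_neg_mul_rpow (p := 1) (s := t) (b := b)
    (by linarith [(Nat.cast_nonneg t : (0 : ℝ) ≤ t)]) one_pos hb
  simpa using this

theorem integral_pow_mul_exp_neg (t : ℕ) {b : ℝ} (hb : 0 < b) :
    ∫ r in Set.Ioi (0 : ℝ), r ^ t * Real.exp (-(b * r)) =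
      (1 / b) ^ (t + 1) * Real.Gamma (t + 1) := by
  have := Real.integral_rpow_mul_exp_neg_mul_Ioi (a := t + 1) (r := b) (by positivity) hb
  simp_rw [add_sub_cancel_right, Real.rpow_natCast] at this
  rw [this, ← Nat.cast_add_one, Real.rpow_natCast]

theorem integral_pow_mul_alternating_exp (t k : ℕ) :
    ∫ r in Set.Ioi (0 : ℝ), r ^ t * ((-1 : ℝ) ^ (k + 1) * Real.exp (-(2 * (k + 1) * r))) =
      (1 / 2) ^ (t + 1) * Real.Gamma (t + 1) * altTerm (t + 1) k := by
  simp_rw [mul_left_comm _ ((-1 : ℝ) ^ (k + 1))]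
  rw [integral_const_mul, integral_pow_mul_exp_neg t (by positivity), altTerm, one_div, one_div,
    mul_inv, mul_pow]
  simp only [inv_pow]
  ring

/-- For `t = 0` the series converges only conditionally, so sum and integral are exchanged by
dominated convergence applied to the partial sums. -/
theorem hasSum_altTerm (t : ℕ) : HasSum (altTerm (t + 1))
    ((∫ r in Set.Ioi (0 : ℝ), r ^ t * (Real.tanh r - 1)) /
      (2 * ((1 / 2) ^ (t + 1) * Real.Gamma (t + 1)))) (SummationFilter.conditional ℕ) := by
  have hΓ : 0 < Real.Gamma (t + 1) := Real.Gamma_pos_of_pos (by positivity)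
  rw [HasSum, SummationFilter.conditional_filter_eq_map_range, Filter.tendsto_map'_iff]
  have key : Filter.Tendsto (fun N ↦ ∫ r in Set.Ioi (0 : ℝ), r ^ t *
      ∑ k ∈ Finset.range N, (-1 : ℝ) ^ (k + 1) * Real.exp (-(2 * (k + 1) * r))) Filter.atTop
      (nhds (∫ r in Set.Ioi (0 : ℝ), r ^ t * ((Real.tanh r - 1) / 2))) := by
    refine tendsto_integral_of_dominated_convergence
      (fun r ↦ 2 * (r ^ t * Real.exp (-(2 * r)))) (fun N ↦ ?_)
      ((integrableOn_pow_mul_exp_neg t two_pos).const_mul 2) (fun N ↦ ?_) ?_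
    · exact Continuous.aestronglyMeasurable (by fun_prop)
    · filter_upwards [ae_restrict_mem measurableSet_Ioi] with r hr
      have hr' : 0 < r := hr
      rw [norm_mul, norm_pow, Real.norm_eq_abs, abs_of_pos hr', Real.norm_eq_abs, mul_left_comm]
      gcongr
      exact abs_sum_alternating_exp_le hr' N
    · filter_upwards [ae_restrict_mem measurableSet_Ioi] with r hr
      exact (tendsto_sum_alternating_exp hr).const_mul _
  have hsum : ∀ N, ∫ r in Set.Ioi (0 : ℝ), r ^ t *
      ∑ k ∈ Finset.range N, (-1 : ℝ) ^ (k + 1) * Real.exp (-(2 * (k + 1) * r)) =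
      ((1 / 2) ^ (t + 1) * Real.Gamma (t + 1)) * ∑ k ∈ Finset.range N, altTerm (t + 1) k := by
    intro N
    simp_rw [Finset.mul_sum]
    rw [integral_finsetSum]
    · exact Finset.sum_congr rfl fun k _ ↦ integral_pow_mul_alternating_exp t k
    · intro k _
      simp_rw [mul_left_comm _ ((-1 : ℝ) ^ (k + 1))]
      exact (integrableOn_pow_mul_exp_neg t (by positivity)).const_mul _
  simp_rw [hsum, ← mul_div_assoc] at key
  rw [integral_div] at key
  have := key.const_mul ((1 / 2) ^ (t + 1) * Real.Gamma (t + 1))⁻¹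
  have hne : ((1 / 2 : ℝ) ^ (t + 1) * Real.Gamma (t + 1)) ≠ 0 := by positivity
  simp_rw [inv_mul_cancel_left₀ hne] at this
  convert this using 2
  · rfl
  rw [div_eq_inv_mul, mul_inv]
  ring

theorem integral_pow_mul_tanh_sub_one (t : ℕ) :
    ∫ r in Set.Ioi (0 : ℝ), r ^ t * (Real.tanh r - 1) =
      2 * ((1 / 2) ^ (t + 1) * Real.Gamma (t + 1)) * altZeta (t + 1) := by
  have hΓ : 0 < Real.Gamma (t + 1) := Real.Gamma_pos_of_pos (by positivity)
  rw [altZeta, (hasSum_altTerm t).tsum_eq, mul_div_cancel₀]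
  positivity

/-! ### Spherical moments -/

theorem integrable_norm_pow_mul_exp_neg_norm {n : ℕ} (hn : 1 ≤ n) (m : ℕ) :
    Integrable (fun x : Euc n ↦ ‖x‖ ^ m * Real.exp (-‖x‖)) := by
  have : Nonempty (Fin n) := ⟨⟨0, hn⟩⟩
  rw [integrable_fun_norm_addHaar volume (f := fun r : ℝ ↦ r ^ m * Real.exp (-r))]
  have := integrableOn_rpow_mul_exp_neg_mul_rpow (p := 1) (s := (n - 1 + m : ℕ)) (b := 1)
    (by linarith [(Nat.cast_nonneg (n - 1 + m) : (0 : ℝ) ≤ (n - 1 + m : ℕ))]) one_pos one_pos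
  simp only [Real.rpow_natCast, Real.rpow_one] at this
  simpa [pow_add, mul_assoc] using this

/-- The exponential series integrated against a function of sufficiently fast decay. -/
theorem hasSum_integral_mul_inner_pow {n : ℕ} {h : Euc n → ℂ} (c : ℂ) (y : Euc n)
    (hm : AEStronglyMeasurable h)
    (hi : Integrable fun x ↦ ‖h x‖ * Real.exp (‖c‖ * ‖y‖ * ‖x‖)) :
    HasSum (fun l : ℕ ↦ c ^ l / l.factorial * ∫ x, h x * ((inner ℝ y x : ℝ) : ℂ) ^ l)
      (∫ x, h x * Complex.exp (c * (inner ℝ y x : ℝ))) := by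
  have hexp (a : ℝ) : HasSum (fun l : ℕ ↦ a ^ l / l.factorial) (Real.exp a) := by
    rw [Real.exp_eq_exp_ℝ]; exact NormedSpace.expSeries_div_hasSum_exp a
  have hcexp (a : ℂ) : HasSum (fun l : ℕ ↦ a ^ l / l.factorial) (Complex.exp a) := by
    rw [Complex.exp_eq_exp_ℂ]; exact NormedSpace.expSeries_div_hasSum_exp a
  simp_rw [← integral_const_mul]
  refine hasSum_integral_of_dominated_convergence
    (fun l x ↦ ‖h x‖ * ((‖c‖ * ‖y‖ * ‖x‖) ^ l / l.factorial)) (fun l ↦ ?_) (fun l ↦ ?_) ?_ ?_ ?_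
  · refine (hm.mul ?_).const_mul _
    exact Continuous.aestronglyMeasurable (by fun_prop)
  · refine .of_forall fun x ↦ ?_
    have h1 : |inner ℝ y x| ≤ ‖y‖ * ‖x‖ := abs_real_inner_le_norm y x
    rw [norm_mul, norm_mul, norm_div, norm_pow, norm_pow, Complex.norm_natCast, Complex.norm_real,
      Real.norm_eq_abs]
    calc ‖c‖ ^ l / l.factorial * (‖h x‖ * |inner ℝ y x| ^ l)
        ≤ ‖c‖ ^ l / l.factorial * (‖h x‖ * (‖y‖ * ‖x‖) ^ l) := by gcongr
      _ = _ := by ring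
  · exact .of_forall fun x ↦ ((hexp _).mul_left _).summable
  · refine hi.congr (.of_forall fun x ↦ ?_)
    exact ((hexp _).mul_left _).tsum_eq.symm
  · refine .of_forall fun x ↦ ?_
    refine HasSum.congr_fun ((hcexp (c * (inner ℝ y x : ℝ))).mul_left (h x)) fun l ↦ ?_
    rw [mul_pow]
    ring

/-- The `l`-th moment of the linear form `⟪y, ·⟫` over the unit sphere. -/
noncomputable def sphereMoment {n : ℕ} (y : Euc n) (l : ℕ) : ℂ :=
  ∫ ω : Metric.sphere (0 : Euc n) 1, ((inner ℝ y (ω : Euc n) : ℝ) : ℂ) ^ l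
    ∂(volume : Measure (Euc n)).toSphere

/-- Polar coordinates `x = rω`: the linear form contributes `r ^ l`, the Jacobian `r ^ (n - 1)`. The
product formula for integrals is unconditional, so `F` is arbitrary. -/
theorem integral_radial_mul_inner_pow {n : ℕ} (hn : 1 ≤ n) (F : ℝ → ℂ) (y : Euc n) (l : ℕ) :
    ∫ x : Euc n, F ‖x‖ * ((inner ℝ y x : ℝ) : ℂ) ^ l =
      sphereMoment y l * ∫ r in Set.Ioi (0 : ℝ), ((r ^ (n - 1 + l) : ℝ) : ℂ) * F r := by
  have : Nonempty (Fin n) := ⟨⟨0, hn⟩⟩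
  let μ : Measure (Euc n) := volume
  calc ∫ x : Euc n, F ‖x‖ * ((inner ℝ y x : ℝ) : ℂ) ^ l
      = ∫ x : ({(0 : Euc n)}ᶜ : Set (Euc n)),
          F ‖(x : Euc n)‖ * ((inner ℝ y (x : Euc n) : ℝ) : ℂ) ^ l ∂(μ.comap (↑)) := by
        rw [integral_subtype_comap (measurableSet_singleton _).compl
          fun x : Euc n ↦ F ‖x‖ * ((inner ℝ y x : ℝ) : ℂ) ^ l, restrict_compl_singleton]
    _ = ∫ p, ((inner ℝ y (p.1 : Euc n) : ℝ) : ℂ) ^ l * (((p.2 : ℝ) : ℂ) ^ l * F p.2)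
          ∂μ.toSphere.prod (.volumeIoiPow (Module.finrank ℝ (Euc n) - 1)) := by
        rw [← μ.measurePreserving_homeomorphUnitSphereProd.integral_comp
          (Homeomorph.measurableEmbedding _)]
        refine integral_congr_ae (.of_forall fun x ↦ ?_)
        have hx : (‖(x : Euc n)‖ : ℂ) ≠ 0 := by
          exact_mod_cast norm_ne_zero_iff.2 x.2
        simp only [homeomorphUnitSphereProd_apply_snd_coe, homeomorphUnitSphereProd_apply_fst_coe,
          inner_smul_right]
        push_cast
        rw [mul_pow, inv_pow]
        field_simp
    _ = sphereMoment y l * ∫ r : Set.Ioi (0 : ℝ), ((r : ℝ) : ℂ) ^ l * F r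
          ∂.volumeIoiPow (Module.finrank ℝ (Euc n) - 1) :=
        integral_prod_mul (fun ω : Metric.sphere (0 : Euc n) 1 ↦ ((inner ℝ y (ω : Euc n) : ℝ) : ℂ) ^ l)
          (fun r : Set.Ioi (0 : ℝ) ↦ ((r : ℝ) : ℂ) ^ l * F r)
    _ = _ := by
        simp only [Measure.volumeIoiPow, ENNReal.ofReal]
        rw [integral_withDensity_eq_integral_smul,
          integral_subtype_comap measurableSet_Ioi fun a : ℝ ↦
            Real.toNNReal (a ^ (Module.finrank ℝ (Euc n) - 1)) • ((a : ℂ) ^ l * F a)]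
        · congr 1
          refine setIntegral_congr_fun measurableSet_Ioi fun x hx ↦ ?_
          have hx' : 0 < x := hx
          simp only [finrank_euclideanSpace, Fintype.card_fin]
          rw [NNReal.smul_def, Real.coe_toNNReal _ (by positivity), Complex.real_smul, pow_add]
          push_cast
          ring
        · exact (measurable_subtype_coe.pow_const _).real_toNNReal

/-! ### Sphere moments from the Gaussian integral -/

theorem eq_of_hasSum_pow_eq {a b : ℕ → ℂ} {f : ℂ → ℂ}
    (ha : ∀ c, HasSum (fun l ↦ c ^ l * a l) (f c)) (hb : ∀ c, HasSum (fun l ↦ c ^ l * b l) (f c)) :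
    a = b := by
  have h (a : ℕ → ℂ) (ha : ∀ c, HasSum (fun l ↦ c ^ l * a l) (f c)) :
      HasFPowerSeriesAt f (FormalMultilinearSeries.ofScalars ℂ a) 0 := by
    rw [hasFPowerSeriesAt_iff]
    exact .of_forall fun c ↦ by simpa using ha c
  funext l
  have := congrArg (fun p ↦ FormalMultilinearSeries.coeff p l)
    ((h a ha).eq_formalMultilinearSeries (h b hb))
  simpa using this

theorem integral_pow_mul_exp_neg_sq (t : ℕ) :
    ∫ r in Set.Ioi (0 : ℝ), ((r ^ t : ℝ) : ℂ) * Complex.exp (-(r : ℂ) ^ 2) =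
      ((Real.Gamma (((t : ℝ) + 1) / 2) / 2 : ℝ) : ℂ) := by
  have h := integral_rpow_mul_exp_neg_rpow (p := 2) (q := t) two_pos
    (by linarith [(Nat.cast_nonneg t : (0 : ℝ) ≤ t)])
  rw [div_eq_inv_mul, ← one_div, ← h, ← integral_complex_ofReal]
  refine integral_congr_ae (.of_forall fun r ↦ ?_)
  simp

/-- The integral of `exp (-‖x‖² + c⟪y, x⟫)` is known in closed form; expanding it in `c` gives a
generating function for the moments, whose coefficients can then be compared. -/
theorem sphereMoment_series {n : ℕ} (hn : 1 ≤ n) (y : Euc n) (c : ℂ) :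
    HasSum (fun l : ℕ ↦ c ^ l * ((l.factorial : ℂ)⁻¹ * (sphereMoment y l *
      ((Real.Gamma (((n - 1 + l : ℕ) + 1 : ℝ) / 2) / 2 : ℝ) : ℂ))))
      ((Real.pi : ℂ) ^ ((n : ℂ) / 2) * Complex.exp (c ^ 2 * ‖y‖ ^ 2 / 4)) := by
  have hb : (0 : ℝ) < (1 : ℂ).re := by simp
  have hg := GaussianFourier.integral_cexp_neg_mul_sq_norm_add_of_euclideanSpace hb c y
  have key := hasSum_integral_mul_inner_pow (h := fun x : Euc n ↦ Complex.exp (-(‖x‖ : ℂ) ^ 2)) c y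
    (Continuous.aestronglyMeasurable (by fun_prop)) ?_
  · convert key using 1
    · funext l
      have := integral_radial_mul_inner_pow hn (fun r ↦ Complex.exp (-(r : ℂ) ^ 2)) y l
      rw [this, integral_pow_mul_exp_neg_sq]
      ring
    · simp_rw [← Complex.exp_add]
      simpa using hg.symm
  -- With `a = ‖c‖‖y‖`, completing the square gives `-r² + a r ≤ (a + 1)² / 4 - r`.
  · refine ((integrable_norm_pow_mul_exp_neg_norm hn 0).const_mul
      (Real.exp ((‖c‖ * ‖y‖ + 1) ^ 2 / 4))).mono'
      (Continuous.aestronglyMeasurable (by fun_prop)) (.of_forall fun x ↦ ?_)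
    have : (-(‖x‖ : ℂ) ^ 2).re = -‖x‖ ^ 2 := by norm_cast
    rw [norm_mul, norm_norm, Complex.norm_exp, this, Real.norm_eq_abs, Real.abs_exp, pow_zero,
      one_mul, ← Real.exp_add, ← Real.exp_add, Real.exp_le_exp]
    nlinarith [sq_nonneg (‖x‖ - (‖c‖ * ‖y‖ + 1) / 2)]

/-- The Taylor coefficients of `c ↦ A * exp (c ^ 2 * B)`. -/
theorem hasSum_exp_sq (A B c : ℂ) :
    HasSum (fun l : ℕ ↦ c ^ l * (if Even l then A * B ^ (l / 2) / (l / 2).factorial else 0))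
      (A * Complex.exp (c ^ 2 * B)) := by
  have hinj : Function.Injective fun j : ℕ ↦ 2 * j := fun a b h ↦ by simpa using h
  rw [← hinj.hasSum_iff]
  · have h : HasSum (fun l : ℕ ↦ (c ^ 2 * B) ^ l / l.factorial) (Complex.exp (c ^ 2 * B)) := by
      rw [Complex.exp_eq_exp_ℂ]; exact NormedSpace.expSeries_div_hasSum_exp _
    refine HasSum.congr_fun (h.mul_left A) fun j ↦ ?_
    simp only [Function.comp_apply, even_two_mul, if_true, Nat.mul_div_cancel_left _ two_pos]
    rw [pow_mul, mul_pow]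
    ring
  · intro l hl
    rw [if_neg, mul_zero]
    rintro ⟨j, hj⟩
    exact hl ⟨j, by grind⟩

theorem sphereMoment_mul_Gamma {n : ℕ} (hn : 1 ≤ n) (y : Euc n) (l : ℕ) :
    (l.factorial : ℂ)⁻¹ * (sphereMoment y l *
      ((Real.Gamma (((n - 1 + l : ℕ) + 1 : ℝ) / 2) / 2 : ℝ) : ℂ)) =
    if Even l then (Real.pi : ℂ) ^ ((n : ℂ) / 2) * ((‖y‖ : ℂ) ^ 2 / 4) ^ (l / 2) /
      (l / 2).factorial else 0 := by
  refine congrFun (eq_of_hasSum_pow_eq (b := fun l ↦ if Even l then (Real.pi : ℂ) ^ ((n : ℂ) / 2) *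
    ((‖y‖ : ℂ) ^ 2 / 4) ^ (l / 2) / (l / 2).factorial else 0) (sphereMoment_series hn y) fun c ↦ ?_) l
  have := hasSum_exp_sq ((Real.pi : ℂ) ^ ((n : ℂ) / 2)) ((‖y‖ : ℂ) ^ 2 / 4) c
  rwa [← mul_div_assoc] at this

theorem sphereMoment_odd {n : ℕ} (hn : 1 ≤ n) (y : Euc n) {l : ℕ} (hl : ¬ Even l) :
    sphereMoment y l = 0 := by
  have h := sphereMoment_mul_Gamma hn y l
  rw [if_neg hl] at h
  have hΓ : 0 < Real.Gamma (((n - 1 + l : ℕ) + 1 : ℝ) / 2) :=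
    Real.Gamma_pos_of_pos (by positivity)
  simpa [Nat.factorial_ne_zero, hΓ.ne', -Nat.cast_add] using h

theorem sphereMoment_even {n : ℕ} (hn : 1 ≤ n) (y : Euc n) (j : ℕ) :
    sphereMoment y (2 * j) = (((2 * j).factorial * Real.pi ^ ((n : ℝ) / 2) * ‖y‖ ^ (2 * j) /
      (2 ^ (2 * j) * j.factorial) * (2 / Real.Gamma (j + (n : ℝ) / 2)) : ℝ) : ℂ) := by
  have h := sphereMoment_mul_Gamma hn y (2 * j)
  have e : ((n - 1 + 2 * j : ℕ) + 1 : ℝ) / 2 = j + (n : ℝ) / 2 := by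
    rw [Nat.cast_add, Nat.cast_sub hn]; push_cast; ring
  have hn' : (0 : ℝ) < n := by exact_mod_cast hn
  have hΓ : 0 < Real.Gamma (j + (n : ℝ) / 2) := Real.Gamma_pos_of_pos (by positivity)
  have hΓ' : (Real.Gamma (j + (n : ℝ) / 2) : ℂ) ≠ 0 := by exact_mod_cast hΓ.ne'
  have hf : ((2 * j).factorial : ℂ) ≠ 0 := by exact_mod_cast Nat.factorial_ne_zero _
  have hf' : (j.factorial : ℂ) ≠ 0 := by exact_mod_cast Nat.factorial_ne_zero _
  rw [e, if_pos (even_two_mul j), Nat.mul_div_cancel_left _ two_pos] at h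
  have hpi : ((Real.pi ^ ((n : ℝ) / 2) : ℝ) : ℂ) = (Real.pi : ℂ) ^ ((n : ℂ) / 2) := by
    rw [Complex.ofReal_cpow Real.pi_pos.le]; push_cast; rfl
  generalize Real.Gamma (j + (n : ℝ) / 2) = G at h hΓ' ⊢
  push_cast [hpi] at h ⊢
  rw [div_pow, ← pow_mul, show (4 : ℂ) = 2 ^ 2 by norm_num, ← pow_mul] at h
  field_simp at h ⊢
  linear_combination h

/-! ### The difference of the two kernels -/

/-- `‖x‖ ^ m * (tanh ‖x‖ - 1)`, the difference of the two kernels. -/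
noncomputable def diffKernel (n m : ℕ) (x : Euc n) : ℂ :=
  ((‖x‖ ^ m * (Real.tanh ‖x‖ - 1) : ℝ) : ℂ)

theorem aestronglyMeasurable_diffKernel (n m : ℕ) :
    AEStronglyMeasurable (diffKernel n m) volume := by
  have h := (tanhKernel_hasPolyGrowth n m).aestronglyMeasurable.sub
    (powerKernel_hasPolyGrowth n m).aestronglyMeasurable
  refine h.congr (.of_forall fun x ↦ ?_)
  simp only [Pi.sub_apply, tanhKernel, powerKernel, diffKernel]
  push_cast
  ring

/-- The decay `exp (-2r)` absorbs `exp (a r)` and still leaves `exp (-r)`. The case `a = ‖y‖`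
supplies the domination in the unit ball. -/
theorem integrable_diffKernel_mul_exp {n : ℕ} (hn : 1 ≤ n) (m : ℕ) {a : ℝ} (ha : a ≤ 1) :
    Integrable fun x : Euc n ↦ ‖diffKernel n m x‖ * Real.exp (a * ‖x‖) := by
  refine ((integrable_norm_pow_mul_exp_neg_norm hn m).const_mul 2).mono'
    ((aestronglyMeasurable_diffKernel n m).norm.mul
      (Continuous.aestronglyMeasurable (by fun_prop))) (.of_forall fun x ↦ ?_)
  rw [norm_mul, norm_norm, diffKernel, Complex.norm_real, norm_mul, norm_pow, norm_norm,
    Real.norm_eq_abs, Real.norm_eq_abs, Real.abs_exp]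
  calc ‖x‖ ^ m * |Real.tanh ‖x‖ - 1| * Real.exp (a * ‖x‖)
      ≤ ‖x‖ ^ m * (2 * Real.exp (-(2 * ‖x‖))) * Real.exp (1 * ‖x‖) := by
        gcongr
        exact abs_tanh_sub_one_le _
    _ = 2 * (‖x‖ ^ m * (Real.exp (-(2 * ‖x‖)) * Real.exp (1 * ‖x‖))) := by ring
    _ = _ := by rw [← Real.exp_add]; ring_nf

theorem integrable_diffKernel {n : ℕ} (hn : 1 ≤ n) (m : ℕ) : Integrable (diffKernel n m) := by
  have h := integrable_diffKernel_mul_exp hn m zero_le_one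
  simp only [zero_mul, Real.exp_zero, mul_one] at h
  exact (integrable_norm_iff (aestronglyMeasurable_diffKernel n m)).1 h

/-- The classical Fourier transform of `diffKernel`. -/
noncomputable def diffFourier (n m : ℕ) (y : Euc n) : ℂ :=
  ∫ x, diffKernel n m x * Complex.exp (-Complex.I * (inner ℝ y x : ℝ))

theorem norm_exp_neg_I_mul (a : ℝ) : ‖Complex.exp (-Complex.I * a)‖ = 1 := by
  rw [show -Complex.I * (a : ℂ) = ((-a : ℝ) : ℂ) * Complex.I by push_cast; ring,
    Complex.norm_exp_ofReal_mul_I]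

theorem continuous_diffFourier {n : ℕ} (hn : 1 ≤ n) (m : ℕ) : Continuous (diffFourier n m) := by
  refine continuous_of_dominated (bound := fun x ↦ ‖diffKernel n m x‖) (fun y ↦ ?_)
    (fun y ↦ .of_forall fun x ↦ ?_) (integrable_diffKernel hn m).norm
    (.of_forall fun x ↦ by fun_prop)
  · exact (aestronglyMeasurable_diffKernel n m).mul
      (Continuous.aestronglyMeasurable (by fun_prop))
  · rw [norm_mul, norm_exp_neg_I_mul, mul_one]

/-- Neither kernel is integrable by itself, but their difference is, so Fubini moves the transform
from `φ` onto it. -/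
theorem gHat_sub_uHat_apply {n : ℕ} (hn : 1 ≤ n) (m : ℕ) (φ : 𝓢(Euc n, ℂ)) :
    (gHat n m - uHat n m) φ = ∫ y, φ y * diffFourier n m y := by
  have h1 : (gHat n m - uHat n m) φ =
      (∫ x, angularFourier n φ x * tanhKernel n m x) -
        ∫ x, angularFourier n φ x * powerKernel n m x := rfl
  rw [h1, ← integral_sub ((tanhKernel_hasPolyGrowth n m).integrable_mul _)
    ((powerKernel_hasPolyGrowth n m).integrable_mul _)]
  calc ∫ x, (angularFourier n φ x * tanhKernel n m x - angularFourier n φ x * powerKernel n m x)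
      = ∫ x, ∫ y, Complex.exp (-Complex.I * (inner ℝ y x : ℝ)) * (diffKernel n m x * φ y) := by
        refine integral_congr_ae (.of_forall fun x ↦ ?_)
        simp only [angularFourier_apply]
        rw [← mul_sub, ← integral_mul_const]
        refine integral_congr_ae (.of_forall fun y ↦ ?_)
        simp only [tanhKernel, powerKernel, diffKernel]
        push_cast
        ring
    _ = ∫ y, ∫ x, Complex.exp (-Complex.I * (inner ℝ y x : ℝ)) * (diffKernel n m x * φ y) := by
        refine integral_integral_swap ?_
        refine Integrable.bdd_mul (c := 1)
          ((integrable_diffKernel hn m).mul_prod φ.integrable) ?_ (.of_forall fun p ↦ ?_)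
        · exact Continuous.aestronglyMeasurable (by fun_prop)
        · exact (norm_exp_neg_I_mul _).le
    _ = _ := by
        refine integral_congr_ae (.of_forall fun y ↦ ?_)
        simp only [diffFourier]
        rw [← integral_const_mul]
        refine integral_congr_ae (.of_forall fun x ↦ ?_)
        ring

/-! ### Identification of the coefficients -/

theorem Gamma_add_nat_eq_prod {x : ℝ} (hx : 0 < x) (m : ℕ) :
    Real.Gamma (x + m) = (∏ i ∈ Finset.range m, (x + i)) * Real.Gamma x := by
  induction m with
  | zero => simp
  | succ m ih =>
    rw [Finset.prod_range_succ, Nat.cast_add_one, ← add_assoc, Real.Gamma_add_one (by positivity),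
      ih]
    ring

/-- The constant `2^{-m+1} π^{(n-1)/2}` in front of the series. -/
noncomputable def seriesConst (n m : ℕ) : ℝ :=
  (2 : ℝ) ^ (-(m : ℤ) + 1) * Real.pi ^ (((n : ℝ) - 1) / 2)

/-- The product is `Γ(n + 2j + m) / Γ(n + 2j)`; Legendre duplication at `j + n/2` converts `Γ(n +
2j) / Γ(j + n/2)` into `Γ(j + (n + 1)/2)`. -/
theorem two_mul_half_pow_mul_Gamma_div {n : ℕ} (hn : 1 ≤ n) (m j : ℕ) :
    2 * ((1 / 2) ^ (m + 2 * j + n) * Real.Gamma (m + 2 * j + n)) * (Real.pi ^ ((n : ℝ) / 2) *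
      (2 / Real.Gamma (j + (n : ℝ) / 2))) =
    seriesConst n m * ((∏ i ∈ Finset.range m, ((n : ℝ) + 2 * j + i)) *
      Real.Gamma (j + ((n : ℝ) + 1) / 2)) := by
  have hn' : (0 : ℝ) < n := by exact_mod_cast hn
  have hΓ : 0 < Real.Gamma (j + (n : ℝ) / 2) := Real.Gamma_pos_of_pos (by positivity)
  have h1 := Gamma_add_nat_eq_prod (x := n + 2 * j) (by positivity) m
  have h2 := Real.Gamma_mul_Gamma_add_half (j + (n : ℝ) / 2)
  rw [show (m : ℝ) + 2 * j + n = n + 2 * j + m by ring, h1, seriesConst]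
  rw [show (j : ℝ) + (n : ℝ) / 2 + 1 / 2 = j + ((n : ℝ) + 1) / 2 by ring,
    show 2 * ((j : ℝ) + (n : ℝ) / 2) = n + 2 * j by ring] at h2
  have hpow : (2 : ℝ) ^ (1 - ((n : ℝ) + 2 * j)) = 2 * (1 / 2) ^ (2 * j + n) := by
    rw [Real.rpow_sub two_pos, Real.rpow_one, one_div, inv_pow, ← Real.rpow_natCast]
    push_cast
    rw [add_comm (n : ℝ), div_eq_mul_inv]
  have hpi : Real.pi ^ ((n : ℝ) / 2) = Real.pi ^ (((n : ℝ) - 1) / 2) * √Real.pi := by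
    rw [Real.sqrt_eq_rpow, ← Real.rpow_add Real.pi_pos]
    ring_nf
  have hm : (2 : ℝ) ^ (-(m : ℤ) + 1) = 2 * (1 / 2) ^ m := by
    rw [zpow_add₀ two_ne_zero, zpow_neg, zpow_natCast, zpow_one, one_div, inv_pow, mul_comm]
  rw [hpow] at h2
  rw [hpi, hm, show m + 2 * j + n = m + (2 * j + n) by ring, pow_add]
  generalize Real.Gamma (j + (n : ℝ) / 2) = G at *
  -- Regrouping isolates `c * (2 * b) * e`, the right side of the duplication formula `h2`.
  rw [show ∀ a b P c d e : ℝ, 2 * (a * b * (P * c)) * (d * e * (2 / G)) =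
    2 * a * d * P * (c * (2 * b) * e / G) from fun a b P c d e ↦ by ring, ← h2]
  field_simp

theorem term_eq {n : ℕ} (hn : 1 ≤ n) (m : ℕ) (y : Euc n) (j : ℕ) :
    (-Complex.I) ^ (2 * j) / (2 * j).factorial *
      ∫ x, diffKernel n m x * ((inner ℝ y x : ℝ) : ℂ) ^ (2 * j) =
    ((seriesConst n m * (coeffP n m j * ‖y‖ ^ (2 * j)) : ℝ) : ℂ) := by
  have hrad := integral_radial_mul_inner_pow hn
    (fun r ↦ ((r ^ m * (Real.tanh r - 1) : ℝ) : ℂ)) y (2 * j)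
  have hI : (-Complex.I) ^ (2 * j) = (((-1) ^ j : ℝ) : ℂ) := by
    rw [pow_mul]; simp
  have hint : ∫ r in Set.Ioi (0 : ℝ), ((r ^ (n - 1 + 2 * j) : ℝ) : ℂ) *
      ((r ^ m * (Real.tanh r - 1) : ℝ) : ℂ) =
      ((2 * ((1 / 2) ^ (m + 2 * j + n) * Real.Gamma (m + 2 * j + n)) *
        altZeta (m + 2 * j + n) : ℝ) : ℂ) := by
    -- The radial power is `(n - 1) + 2j + m`; one more than it is both the Gamma argument and the
    -- exponent in `altZeta`.
    have h := integral_pow_mul_tanh_sub_one (m + 2 * j + n - 1)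
    rw [Nat.cast_sub (by omega), Nat.sub_add_cancel (by omega)] at h
    push_cast at h
    rw [sub_add_cancel] at h
    rw [← h, ← integral_complex_ofReal]
    refine integral_congr_ae (.of_forall fun r ↦ ?_)
    simp only
    rw [show m + 2 * j + n - 1 = n - 1 + 2 * j + m by omega, pow_add _ _ m]
    push_cast
    ring
  have hdup := two_mul_half_pow_mul_Gamma_div hn m j
  unfold diffKernel
  rw [hrad, hint, sphereMoment_even hn, hI, coeffP, ← Complex.ofReal_natCast, ← Complex.ofReal_div,
    ← Complex.ofReal_mul, ← Complex.ofReal_mul]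
  congr 1
  have hf : ((2 * j).factorial : ℝ) ≠ 0 := by exact_mod_cast Nat.factorial_ne_zero _
  have hf' : (j.factorial : ℝ) ≠ 0 := by exact_mod_cast Nat.factorial_ne_zero _
  trans (-1) ^ j * ‖y‖ ^ (2 * j) / (2 ^ (2 * j) * j.factorial) * altZeta (m + 2 * j + n) *
    (2 * ((1 / 2) ^ (m + 2 * j + n) * Real.Gamma (m + 2 * j + n)) * (Real.pi ^ ((n : ℝ) / 2) *
      (2 / Real.Gamma (j + (n : ℝ) / 2))))
  · field_simp
  · rw [hdup]
    ring

theorem hasSum_diffFourier {n : ℕ} (hn : 1 ≤ n) (m : ℕ) {y : Euc n} (hy : ‖y‖ < 1) :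
    HasSum (fun j : ℕ ↦ ((seriesConst n m * (coeffP n m j * ‖y‖ ^ (2 * j)) : ℝ) : ℂ))
      (diffFourier n m y) := by
  have h := hasSum_integral_mul_inner_pow (-Complex.I) y (aestronglyMeasurable_diffKernel n m)
    (integrable_diffKernel_mul_exp hn m (by simpa using hy.le))
  have hinj : Function.Injective fun j : ℕ ↦ 2 * j := fun a b h ↦ by simpa using h
  rw [← hinj.hasSum_iff] at h
  · exact h.congr_fun fun j ↦ (term_eq hn m y j).symm
  · intro l hl
    have hodd : ¬ Even l := by
      rintro ⟨j, hj⟩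
      exact hl ⟨j, by grind⟩
    have := integral_radial_mul_inner_pow hn
      (fun r ↦ ((r ^ m * (Real.tanh r - 1) : ℝ) : ℂ)) y l
    unfold diffKernel
    rw [this, sphereMoment_odd hn y hodd, zero_mul, mul_zero]

theorem seriesConst_pos (n m : ℕ) : 0 < seriesConst n m := by
  unfold seriesConst
  positivity

/-- Convergence is inherited from the termwise integration, so no growth estimate on `p_j` is
needed. -/
theorem summable_coeffP {n : ℕ} (hn : 1 ≤ n) (m : ℕ) {y : Euc n} (hy : ‖y‖ < 1) :
    Summable fun j : ℕ ↦ coeffP n m j * ‖y‖ ^ (2 * j) := by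
  have h := Complex.summable_ofReal.1 (hasSum_diffFourier hn m hy).summable
  exact (summable_mul_left_iff (seriesConst_pos n m).ne').1 h

theorem diffFourier_eq_seriesPart {n : ℕ} (hn : 1 ≤ n) (m : ℕ) {y : Euc n} (hy : ‖y‖ < 1) :
    diffFourier n m y = seriesPart n m y := by
  rw [← (hasSum_diffFourier hn m hy).tsum_eq, ← Complex.ofReal_tsum, tsum_mul_left]
  rfl

theorem mainTheorem1 (n m : ℕ) (hn : 1 ≤ n) :
    (∀ j : ℕ, Summable (altTerm (m + 2 * j + n)) (SummationFilter.conditional ℕ)) ∧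
    (∀ y : Euc n, ‖y‖ < 1 → Summable fun j : ℕ ↦ |coeffP n m j * ‖y‖ ^ (2 * j)|) ∧
    EqFunctionOn (gHat n m - uHat n m) (seriesPart n m) (Metric.ball 0 1) := by
  have heq : ∀ y ∈ Metric.ball (0 : Euc n) 1, seriesPart n m y = diffFourier n m y :=
    fun y hy ↦ (diffFourier_eq_seriesPart hn m (mem_ball_zero_iff.1 hy)).symm
  refine ⟨fun j ↦ ?_, fun y hy ↦ (summable_coeffP hn m hy).abs, ?_, fun φ _ hφ ↦ ?_⟩
  · have h := (hasSum_altTerm (m + 2 * j + n - 1)).summable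
    rwa [Nat.sub_add_cancel (by omega)] at h
  · exact ((continuous_diffFourier hn m).continuousOn.congr heq).locallyIntegrableOn
      measurableSet_ball
  -- The series is replaced by `diffFourier` inside the ball before the integral is extended to the
  -- whole space, where `φ` vanishes off the ball.
  · rw [gHat_sub_uHat_apply hn, setIntegral_congr_fun measurableSet_ball
      (g := fun y ↦ φ y * diffFourier n m y) fun y hy ↦ by simp only [heq y hy],
      setIntegral_eq_integral_of_forall_compl_eq_zero]
    intro y hy
    rw [image_eq_zero_of_notMem_tsupport fun h ↦ hy (hφ h), zero_mul]
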